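/- \textbf{Theorem (Kleene--Schützenberger characterisation of stochastic regular languages).} Let $\Sigma$ be a finite alphabet. A \emph{quantitative language} is a function $f:\Sigma^*\to\mathbb R$; it is \emph{stochastic} if $f(w)\ge 0$ for all $w$ and $\sum_{w\in\Sigma^*}f(w)=1$. Let $\mathcal S^{rat}_{\mathbb R_{\ge0}}(\Sigma^*)$ be the set of stochastic languages of the form $w_1\cdots w_n\mapsto \lambda^\top M_{w_1}\cdots M_{w_n}\mu$, where $\lambda,\mu\in\mathbb R_{\ge0}^Q$ and $M_\sigma\in\mathbb R_{\ge0}^{Q\times Q}$ ($\sigma\in\Sigma$) for a finite set $Q$. Write $\delta_u$ for the Dirac distribution at the word $u$ and $\varepsilon$ for the empty word. For $\alpha\in(0,1)$ consider the convex combination $\alpha f+(1-\alpha)g$, the Cauchy product $(f\cdot g)(w)=\sum_{w=uv}f(u)g(v)$, and the discounted Kleene star \[ f^*_\alpha(w)=\sum_{k\ge1}\ \sum_{\substack{w_1,\dots,w_k\in\Sigma^+\\ w=w_1\cdots w_k}}\alpha(1-\alpha)^{k-1}\prod_{i=1}^k f(w_i). \] Stochastic regular expressions (SREs) are given by the grammar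 $r::=\delta_\sigma\mid \alpha r_1+(1-\alpha)r_2\mid r_1\cdot r_2\mid r^*_\alpha$ with $\sigma\in\Sigma$, $\alpha\in(0,1)$, and denote quantitative languages through these operations. Then: (1) $\{f\in\mathcal S^{rat}_{\mathbb R_{\ge0}}(\Sigma^*) : f(\varepsilon)=0\}$ is the smallest class of quantitative languages over $\Sigma$ that contains $\delta_\sigma$ for every $\sigma\in\Sigma$ and is closed under convex combinations, Cauchy products and discounted Kleene stars. (2) The quantitative languages denoted by SREs are exactly those of $\{f\in\mathcal S^{rat}_{\mathbb R_{\ge0}}(\Sigma^*) : f(\varepsilon)=0\}$. (3) The whole of $\mathcal S^{rat}_{\mathbb R_{\ge0}}(\Sigma^*)$ is the smallest class of quantitative languages over $\Sigma$ that contains $\delta_\varepsilon$ and $\delta_\sigma$ for every $\sigma\in\Sigma$ and is closed under convex combinations, Cauchy products, and discounted Kleene stars $f^*_\alpha$ of those members $f$ with $f(\varepsilon)=0$. -/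

import Mathlib

open scoped NNReal Matrix

namespace StochLang

universe u

/-- A quantitative language over the alphabet `A`: a real-valued function on words. -/
abbrev QLang (A : Type u) : Type u := List A → ℝ

/-- A stochastic language: pointwise non-negative, of total mass one. -/
def IsStochastic {A : Type u} (f : QLang A) : Prop :=
  (∀ w, 0 ≤ f w) ∧ HasSum f 1

open Classical in
/-- The Dirac distribution concentrated on the word `w`. -/
noncomputable def dirac {A : Type u} (w : List A) : QLang A :=
  fun v => if v = w then 1 else 0

/-- The convex combination `c f + (1 - c) g`. -/
noncomputable def convexComb {A : Type u} (c : ℝ) (f g : QLang A) : QLang A :=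
  fun w => c * f w + (1 - c) * g w

/-- The Cauchy product: the sum of `f u * g v` over all `w = u v`. The pairs `(u, v)` with
`u v = w` are listed, each exactly once, as the prefix of length `i` and the corresponding suffix,
for `0 ≤ i ≤ |w|`. -/
noncomputable def cauchy {A : Type u} (f g : QLang A) : QLang A :=
  fun w => ∑ i ∈ Finset.range (w.length + 1), f (w.take i) * g (w.drop i)

/-- The sequences `(w₁, …, w_k)` of `k` non-empty words with `w₁ ⋯ w_k = w`. -/
def factorizations {A : Type u} (k : ℕ) (w : List A) : Set (List (List A)) :=
  {ws | ws.length = k ∧ (∀ v ∈ ws, v ≠ []) ∧ ws.flatten = w}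

/-- The discounted Kleene star with parameter `c`:
`w ↦ ∑_{k ≥ 1} ∑_{w = w₁ ⋯ w_k, w_i ≠ ε} c (1 - c)^(k - 1) ∏ f(w_i)`; the outer sum is indexed by
`k - 1`. Both sums have finitely many non-zero terms, see the two lemmas below. -/
noncomputable def star {A : Type u} (c : ℝ) (f : QLang A) : QLang A :=
  fun w => ∑' k : ℕ, ∑ᶠ ws ∈ factorizations (k + 1) w, c * (1 - c) ^ k * (ws.map f).prod

theorem factorizations_finite {A : Type u} (k : ℕ) (w : List A) :
    (factorizations k w).Finite := by
  induction k generalizing w with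
  | zero =>
    refine (Set.finite_singleton ([] : List (List A))).subset ?_
    rintro ws ⟨h, -, -⟩
    simpa using h
  | succ k ih =>
    refine ((Set.finite_Iic w.length).biUnion
      (fun i _ => (ih (w.drop i)).image (List.cons (w.take i)))).subset ?_
    rintro ws ⟨h1, h2, h3⟩
    cases ws with
    | nil => simp at h1
    | cons v vs =>
      simp only [List.flatten_cons] at h3
      subst h3
      simp only [Set.mem_iUnion]
      refine ⟨v.length, by simp, vs, ⟨by simpa using h1, fun x hx => h2 x (by simp [hx]), ?_⟩, ?_⟩
      · simp
      · simp

theorem factorizations_eq_empty {A : Type u} (k : ℕ) (w : List A) (h : w.length < k) :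
    factorizations k w = ∅ := by
  have key : ∀ ws : List (List A), (∀ v ∈ ws, v ≠ []) → ws.length ≤ ws.flatten.length := by
    intro ws
    induction ws with
    | nil => simp
    | cons v vs ih =>
      intro hv
      have h1 := ih (fun x hx => hv x (by simp [hx]))
      have h2 : 0 < v.length := List.length_pos_iff.mpr (hv v (by simp))
      simp only [List.length_cons, List.flatten_cons, List.length_append]
      omega
  ext ws
  simp only [Set.mem_empty_iff_false, iff_false]
  rintro ⟨h1, h2, h3⟩
  have := key ws h2
  rw [h1, h3] at this
  omega

/-- A weighted automaton over the semiring `K` with alphabet `A` and state set `Q`. -/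
structure WFA (K : Type) (A : Type u) (Q : Type) where
  /-- initial weights -/
  init : Q → K
  /-- transition matrices -/
  trans : A → Matrix Q Q K
  /-- final weights -/
  final : Q → K

/-- The weight `λᵀ M_{w₁} ⋯ M_{w_n} μ` of the word `w = w₁ ⋯ w_n`. -/
def WFA.weight {K : Type} [Semiring K] {A : Type u} {Q : Type} [Fintype Q] [DecidableEq Q]
    (W : WFA K A Q) (w : List A) : K :=
  W.init ⬝ᵥ ((w.map W.trans).prod *ᵥ W.final)

/-- The stochastic languages over `A` that are the semantics of a finite weighted automaton over
the semiring of non-negative reals. -/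
def SRat (A : Type u) : Set (QLang A) :=
  {f | IsStochastic f ∧
    ∃ (Q : Type) (_ : Fintype Q) (_ : DecidableEq Q) (W : WFA ℝ≥0 A Q),
      ∀ w, f w = (W.weight w : ℝ)}

/-- Closure of a class of quantitative languages under convex combinations, Cauchy products, and
discounted Kleene stars of its members that give no weight to the empty word. -/
structure ClosedUnderProperOps {A : Type u} (C : Set (QLang A)) : Prop where
  convexComb_mem : ∀ c ∈ Set.Ioo (0 : ℝ) 1, ∀ f ∈ C, ∀ g ∈ C, convexComb c f g ∈ C
  cauchy_mem : ∀ f ∈ C, ∀ g ∈ C, cauchy f g ∈ C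
  star_mem : ∀ c ∈ Set.Ioo (0 : ℝ) 1, ∀ f ∈ C, f [] = 0 → star c f ∈ C

/-- Closure under convex combinations, Cauchy products and all discounted Kleene stars. -/
structure ClosedUnderOps {A : Type u} (C : Set (QLang A)) : Prop where
  convexComb_mem : ∀ c ∈ Set.Ioo (0 : ℝ) 1, ∀ f ∈ C, ∀ g ∈ C, convexComb c f g ∈ C
  cauchy_mem : ∀ f ∈ C, ∀ g ∈ C, cauchy f g ∈ C
  star_mem : ∀ c ∈ Set.Ioo (0 : ℝ) 1, ∀ f ∈ C, star c f ∈ C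

/-- Stochastic regular expressions. -/
inductive SRE (A : Type u) : Type u
  | sym (a : A) : SRE A
  | conv (c : ℝ) (hc : c ∈ Set.Ioo (0 : ℝ) 1) (r s : SRE A) : SRE A
  | cat (r s : SRE A) : SRE A
  | star (c : ℝ) (hc : c ∈ Set.Ioo (0 : ℝ) 1) (r : SRE A) : SRE A

/-- The quantitative language denoted by a stochastic regular expression. -/
noncomputable def SRE.denote {A : Type u} : SRE A → QLang A
  | .sym a => dirac [a]
  | .conv c _ r s => convexComb c r.denote s.denote
  | .cat r s => cauchy r.denote s.denote
  | .star c _ r => StochLang.star c r.denote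

end StochLang

/-! Quantitative languages form a ring under the Cauchy product, in which the discounted star of a
proper `f` (one with `f [] = 0`) solves `x = c f + (1 - c) f x`. For closure, `mem_SRat_iff`
replaces automata by finitely generated cones of non-negative series stable under left derivatives;
the product rule for derivatives yields such cones for products and stars. Mass is multiplicative
(`Ser.hasSum_mul`), so the operations preserve stochasticity.

For the converse, the states of an automaton are eliminated one at a time. Kleene's elimination
needs the sum of all `e ^ k` for a loop coefficient `e`, whereas only discounted stars are
available. The coefficients are kept in the cone of multiples `c • r` of expressions `r`; if `c <
1`, the sum of `c ^ k r ^ k` over `k ≥ 1` is `c / (1 - c)` times the star of `r` with parameter `1 -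
c`. The bound `c < 1` is a mass argument (`exists_quasi_inverse`): a state with non-zero language of
finite mass cannot carry a loop of mass at least one. Elimination (`mem_unitalCone_of_system`) gives
`f = c δ_ε + d r`, and total mass one forces `c + d = 1`. -/

namespace StochLang

universe u

/-! ### The ring of non-commutative power series -/

/-- Formal power series in non-commuting variables `A` with real coefficients: quantitative
languages, with the Cauchy product as multiplication. -/
def Ser (A : Type u) : Type u := List A → ℝ

namespace Ser

variable {A : Type u}

noncomputable instance : AddCommGroup (Ser A) := inferInstanceAs (AddCommGroup (List A → ℝ))

noncomputable instance : Module ℝ (Ser A) := inferInstanceAs (Module ℝ (List A → ℝ))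

noncomputable instance : Mul (Ser A) := ⟨fun f g => cauchy f g⟩

noncomputable instance : One (Ser A) := ⟨dirac []⟩

/-- The left derivative of a series with respect to a letter. -/
def deriv (a : A) (f : Ser A) : Ser A := fun w => f (a :: w)

theorem ext_apply {f g : Ser A} (h : ∀ w, f w = g w) : f = g := funext h

@[simp] theorem zero_apply (w : List A) : (0 : Ser A) w = 0 := rfl

@[simp] theorem add_apply (f g : Ser A) (w : List A) : (f + g) w = f w + g w := rfl

@[simp] theorem smul_apply (c : ℝ) (f : Ser A) (w : List A) : (c • f) w = c * f w := rfl

@[simp] theorem nnreal_smul_apply (c : ℝ≥0) (f : Ser A) (w : List A) : (c • f) w = c * f w := rfl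

theorem mul_apply (f g : Ser A) (w : List A) :
    (f * g) w = ∑ i ∈ Finset.range (w.length + 1), f (w.take i) * g (w.drop i) := rfl

@[simp] theorem one_nil : (1 : Ser A) [] = 1 := by
  change dirac [] [] = 1
  simp [dirac]

@[simp] theorem one_cons (a : A) (w : List A) : (1 : Ser A) (a :: w) = 0 := by
  change dirac [] (a :: w) = 0
  simp [dirac]

@[simp] theorem mul_nil (f g : Ser A) : (f * g) [] = f [] * g [] := by simp [mul_apply]

/-- A cut of `a :: w` either leaves the left part empty or puts the letter `a` into it. -/
theorem mul_cons (f g : Ser A) (a : A) (w : List A) :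
    (f * g) (a :: w) = f [] * g (a :: w) + (deriv a f * g) w := by
  rw [mul_apply, List.length_cons, Finset.sum_range_succ']
  simp [mul_apply, deriv, add_comm]

@[simp] theorem deriv_apply (a : A) (f : Ser A) (w : List A) : deriv a f w = f (a :: w) := rfl

theorem ext_deriv {f g : Ser A} (h : f [] = g []) (h' : ∀ a, deriv a f = deriv a g) : f = g := by
  funext w
  cases w with
  | nil => exact h
  | cons a w => exact congrFun (h' a) w

@[simp] theorem deriv_add (a : A) (f g : Ser A) : deriv a (f + g) = deriv a f + deriv a g := rfl

@[simp] theorem deriv_smul (a : A) (c : ℝ) (f : Ser A) : deriv a (c • f) = c • deriv a f := rfl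

@[simp] theorem deriv_nnreal_smul (a : A) (c : ℝ≥0) (f : Ser A) :
    deriv a (c • f) = c • deriv a f := rfl

@[simp] theorem deriv_one (a : A) : deriv a (1 : Ser A) = 0 := by
  funext w
  exact one_cons a w

theorem deriv_mul (a : A) (f g : Ser A) :
    deriv a (f * g) = f [] • deriv a g + deriv a f * g := by
  funext w
  exact mul_cons f g a w

theorem add_mul_apply (f g h : Ser A) : (f + g) * h = f * h + g * h := by
  refine ext_apply fun w => ?_
  simp [mul_apply, add_mul, Finset.sum_add_distrib]

theorem mul_add_apply (f g h : Ser A) : f * (g + h) = f * g + f * h := by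
  refine ext_apply fun w => ?_
  simp [mul_apply, mul_add, Finset.sum_add_distrib]

theorem smul_mul (c : ℝ) (f g : Ser A) : (c • f) * g = c • (f * g) := by
  refine ext_apply fun w => ?_
  simp [mul_apply, Finset.mul_sum, mul_assoc]

theorem mul_smul' (c : ℝ) (f g : Ser A) : f * (c • g) = c • (f * g) := by
  refine ext_apply fun w => ?_
  simp [mul_apply, Finset.mul_sum, mul_left_comm]

theorem zero_mul' (f : Ser A) : 0 * f = 0 := by
  refine ext_apply fun w => ?_
  simp [mul_apply]

theorem mul_zero' (f : Ser A) : f * 0 = 0 := by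
  refine ext_apply fun w => ?_
  simp [mul_apply]

theorem one_mul' (f : Ser A) : 1 * f = f :=
  ext_deriv (by simp) fun a => by rw [deriv_mul]; simp [zero_mul']

theorem mul_one' (f : Ser A) : f * 1 = f := by
  refine ext_apply fun w => ?_
  induction w generalizing f with
  | nil => simp
  | cons a w ih => rw [mul_cons, ih]; simp

theorem mul_assoc' (f g h : Ser A) : f * g * h = f * (g * h) := by
  refine ext_apply fun w => ?_
  induction w generalizing f with
  | nil => simp [mul_assoc]
  | cons a w ih =>
    rw [mul_cons, mul_cons, mul_cons, deriv_mul, add_mul_apply, smul_mul, add_apply, ih, mul_nil,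
      smul_apply]
    ring

noncomputable instance : Ring (Ser A) :=
  { (inferInstance : AddCommGroup (Ser A)) with
    mul := (· * ·)
    one := 1
    left_distrib := mul_add_apply
    right_distrib := add_mul_apply
    zero_mul := zero_mul'
    mul_zero := mul_zero'
    mul_assoc := mul_assoc'
    one_mul := one_mul'
    mul_one := mul_one' }

noncomputable instance : IsScalarTower ℝ (Ser A) (Ser A) := ⟨smul_mul⟩

noncomputable instance : SMulCommClass ℝ (Ser A) (Ser A) := ⟨fun c f g => (mul_smul' c f g).symm⟩

@[simp] theorem sum_apply {ι : Type*} (s : Finset ι) (f : ι → Ser A) (w : List A) :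
    (∑ i ∈ s, f i) w = ∑ i ∈ s, f i w := Finset.sum_apply w s f

@[simp] theorem deriv_sum {ι : Type*} (a : A) (s : Finset ι) (f : ι → Ser A) :
    deriv a (∑ i ∈ s, f i) = ∑ i ∈ s, deriv a (f i) := by
  refine ext_apply fun w => ?_
  simp

/-- The series of a single letter. -/
noncomputable def letter (a : A) : Ser A := dirac [a]

@[simp] theorem letter_nil (a : A) : letter a [] = 0 := by
  change dirac [a] [] = 0
  simp [dirac]

theorem deriv_letter_self (a : A) : deriv a (letter a) = 1 := by
  refine ext_apply fun w => ?_
  change dirac [a] (a :: w) = _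
  cases w <;> simp [dirac]

theorem deriv_letter_of_ne {a b : A} (h : a ≠ b) : deriv a (letter b) = 0 := by
  refine ext_apply fun w => ?_
  change dirac [b] (a :: w) = 0
  simp [dirac, h]

/-- A homogeneous linear equation with proper coefficient has only the trivial solution. -/
theorem eq_zero_of_eq_mul {e x : Ser A} (he : e [] = 0) (h : x = e * x) : x = 0 := by
  refine ext_apply fun w => ?_
  induction hn : w.length using Nat.strong_induction_on generalizing w with
  | _ n ih =>
    rw [h, mul_apply]
    refine Finset.sum_eq_zero fun i hi => ?_
    -- The empty prefix has weight `e [] = 0`; any other cut leaves a shorter suffix, or `w` is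
    -- empty.
    rcases Nat.eq_zero_or_pos i with rfl | hi0
    · simp [he]
    · rcases w with _ | ⟨a, w⟩
      · simp [he]
      · rw [ih _ _ (List.drop i (a :: w)) rfl]
        · simp
        · subst hn
          simp only [List.length_drop, List.length_cons]
          omega

/-- Uniqueness in Arden's lemma: the difference of two solutions solves the homogeneous equation. -/
theorem eq_of_eq_mul_add {e r x y : Ser A} (he : e [] = 0) (hx : x = r + e * x)
    (hy : y = r + e * y) : x = y := by
  refine sub_eq_zero.mp (eq_zero_of_eq_mul he ?_)
  conv_lhs => rw [hx, hy]
  rw [mul_sub]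
  abel

theorem pow_apply_eq_zero {f : Ser A} (hf : f [] = 0) {k : ℕ} {w : List A} (h : w.length < k) :
    (f ^ k) w = 0 := by
  induction k generalizing w with
  | zero => omega
  | succ k ih =>
    rw [pow_succ', mul_apply]
    refine Finset.sum_eq_zero fun i hi => ?_
    rcases Nat.eq_zero_or_pos i with rfl | hi0
    · simp [hf]
    · rcases w with _ | ⟨a, w⟩
      · simp [hf]
      · rw [ih, mul_zero]
        simp only [List.length_drop, List.length_cons] at h ⊢
        omega

theorem mul_nonneg' {f g : Ser A} (hf : ∀ w, 0 ≤ f w) (hg : ∀ w, 0 ≤ g w) (w : List A) :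
    0 ≤ (f * g) w := by
  rw [mul_apply]
  exact Finset.sum_nonneg fun _ _ => mul_nonneg (hf _) (hg _)

/-- Pairs of words correspond to words with a cut position. -/
def splitEquiv (A : Type u) : (Σ w : List A, Fin (w.length + 1)) ≃ List A × List A where
  toFun p := (p.1.take p.2, p.1.drop p.2)
  invFun p := ⟨p.1 ++ p.2, ⟨p.1.length, by simp⟩⟩
  left_inv := by
    rintro ⟨w, i, hi⟩
    have h : (w.take i).length = i := by
      rw [List.length_take]; exact Nat.min_eq_left (Nat.lt_succ_iff.1 hi)
    ext1
    · simp
    · refine (Fin.heq_ext_iff (by simp)).2 ?_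
      simpa using h
  right_inv := by
    rintro ⟨u, v⟩
    simp

/-- The product of the masses is a sum over pairs of words, regrouped by their concatenation. -/
theorem hasSum_mul {f g : Ser A} {a b : ℝ} (hf : ∀ w, 0 ≤ f w) (hg : ∀ w, 0 ≤ g w)
    (ha : HasSum f a) (hb : HasSum g b) : HasSum (f * g) (a * b) := by
  have h := ha.mul hb (ha.summable.mul_of_nonneg hb.summable hf hg)
  rw [← (splitEquiv A).hasSum_iff] at h
  refine h.sigma fun w => ?_
  rw [mul_apply, ← Fin.sum_univ_eq_sum_range (fun i => f (w.take i) * g (w.drop i))]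
  exact hasSum_fintype _

end Ser

/-! ### Stochasticity of the operations -/

theorem isStochastic_one {A : Type u} : IsStochastic (1 : Ser A) := by
  refine ⟨fun w => ?_, ?_⟩
  · cases w <;> simp
  · simpa using hasSum_single (f := (1 : Ser A)) [] (by rintro (_ | ⟨a, w⟩) h <;> simp_all)

theorem isStochastic_dirac {A : Type u} (u : List A) : IsStochastic (dirac u) := by
  refine ⟨fun w => ?_, ?_⟩
  · unfold dirac; split_ifs <;> simp
  · simpa [dirac] using hasSum_single (f := dirac u) u (fun w h => if_neg h)

theorem IsStochastic.mul {A : Type u} {f g : Ser A} (hf : IsStochastic f) (hg : IsStochastic g) :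
    IsStochastic (f * g) :=
  ⟨Ser.mul_nonneg' hf.1 hg.1, by simpa using Ser.hasSum_mul hf.1 hg.1 hf.2 hg.2⟩

theorem IsStochastic.pow {A : Type u} {f : Ser A} (hf : IsStochastic f) (k : ℕ) :
    IsStochastic (f ^ k) := by
  induction k with
  | zero => simpa using isStochastic_one
  | succ k ih => rw [pow_succ]; exact ih.mul hf

theorem IsStochastic.convexComb {A : Type u} {f g : QLang A} (hf : IsStochastic f)
    (hg : IsStochastic g) {c : ℝ} (hc : c ∈ Set.Ioo (0 : ℝ) 1) :
    IsStochastic (convexComb c f g) := by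
  refine ⟨fun w => add_nonneg (mul_nonneg hc.1.le (hf.1 w))
    (mul_nonneg (sub_nonneg.2 hc.2.le) (hg.1 w)), ?_⟩
  have h := (hf.2.mul_left c).add (hg.2.mul_left (1 - c))
  rwa [mul_one, mul_one, add_sub_cancel] at h

theorem factorizations_succ {A : Type u} (k : ℕ) (w : List A) :
    factorizations (k + 1) w =
      ⋃ i ∈ (Finset.Icc 1 w.length : Finset ℕ),
        List.cons (w.take i) '' factorizations k (w.drop i) := by
  ext ws
  simp only [Set.mem_iUnion, Set.mem_image, Finset.mem_Icc, exists_prop]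
  constructor
  · rintro ⟨h1, h2, h3⟩
    cases ws with
    | nil => simp at h1
    | cons v vs =>
      simp only [List.flatten_cons] at h3
      subst h3
      have := List.length_pos_iff.mpr (h2 v (by simp))
      refine ⟨v.length, ⟨this, by simp⟩, vs,
        ⟨by simpa using h1, fun x hx => h2 x (by simp [hx]), ?_⟩, ?_⟩ <;> simp
  · rintro ⟨i, ⟨hi, hi'⟩, vs, ⟨h1, h2, h3⟩, rfl⟩
    refine ⟨by simpa using h1, ?_, by simp [h3]⟩
    intro v hv
    rcases List.mem_cons.1 hv with rfl | hv
    · rw [← List.length_pos_iff, List.length_take]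
      omega
    · exact h2 v hv

/-- Powers of `f` also count empty factors, but these contribute nothing because `f [] = 0`. -/
theorem finsum_factorizations {A : Type u} {f : Ser A} (hf : f [] = 0) (k : ℕ) (w : List A) :
    ∑ᶠ ws ∈ factorizations k w, (ws.map fun v => f v).prod = (f ^ k) w := by
  induction k generalizing w with
  | zero =>
    rcases w with _ | ⟨a, w⟩
    · have : factorizations 0 ([] : List A) = {[]} := by
        ext ws
        simp only [factorizations, Set.mem_ofPred_eq, Set.mem_singleton_iff, List.length_eq_zero_iff]
        constructor
        · exact fun h => h.1
        · rintro rfl; simp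
      rw [this, finsum_mem_singleton, pow_zero, Ser.one_nil, List.map_nil, List.prod_nil]
    · have : factorizations 0 (a :: w) = ∅ := by
        ext ws
        simp only [factorizations, Set.mem_ofPred_eq, List.length_eq_zero_iff,
          Set.mem_empty_iff_false, iff_false]
        rintro ⟨rfl, -, h⟩
        simp at h
      rw [this, finsum_mem_empty]
      simp
  | succ k ih =>
    rw [factorizations_succ]
    have hd : Set.PairwiseDisjoint ((Finset.Icc 1 w.length : Finset ℕ) : Set ℕ)
        (fun i => List.cons (w.take i) '' factorizations k (w.drop i)) := by
      intro i hi j hj hij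
      refine Set.disjoint_left.2 ?_
      rintro _ ⟨vs, -, rfl⟩ ⟨vs', -, h⟩
      apply hij
      have h' := congrArg List.length (List.cons.inj h).1
      simp only [Finset.coe_Icc, Set.mem_Icc, List.length_take] at hi hj h'
      omega
    have := finsum_mem_biUnion (f := fun ws : List (List A) => (ws.map fun v => f v).prod) hd
      (Finset.finite_toSet _) (fun i _ => (factorizations_finite k (w.drop i)).image _)
    simp only [Finset.mem_coe] at this
    rw [this, finsum_mem_finset_eq_sum, pow_succ', Ser.mul_apply, Finset.sum_range_succ',
      List.take_zero, hf, zero_mul, add_zero, Finset.range_eq_Ico,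
      Finset.sum_Ico_add' (fun i => f (w.take i) * (f ^ k) (w.drop i)) 0 w.length 1]
    refine Finset.sum_congr rfl fun i _ => ?_
    rw [finsum_mem_image (List.cons_injective.injOn), ← ih]
    simp only [List.map_cons, List.prod_cons]
    exact (mul_finsum_mem' _ _ (factorizations_finite _ _)).symm

theorem star_apply {A : Type u} {f : Ser A} (hf : f [] = 0) (c : ℝ) (w : List A) :
    star c f w = ∑' k : ℕ, c * (1 - c) ^ k * (f ^ (k + 1)) w := by
  refine tsum_congr fun k => ?_
  rw [← finsum_factorizations hf]
  exact (mul_finsum_mem' _ _ (factorizations_finite _ _)).symm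

theorem summable_star {A : Type u} {f : Ser A} (hf : f [] = 0) (c : ℝ) (w : List A) :
    Summable fun k : ℕ => c * (1 - c) ^ k * (f ^ (k + 1)) w :=
  summable_of_ne_finset_zero (s := Finset.range w.length) fun k hk => by
    rw [Ser.pow_apply_eq_zero hf (by simp at hk; omega), mul_zero]

/-- The star is the mixture of the stochastic series `f ^ (k + 1)` with geometric weights;
non-negativity allows summing over words or over `k` first. -/
theorem IsStochastic.star {A : Type u} {f : Ser A} (hf : IsStochastic f) (h0 : f [] = 0) {c : ℝ}
    (hc : c ∈ Set.Ioo (0 : ℝ) 1) : IsStochastic (star c f) := by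
  have hc0 := hc.1.le
  have hc1 : 0 ≤ 1 - c := sub_nonneg.2 hc.2.le
  have hn (k : ℕ) (w : List A) : 0 ≤ c * (1 - c) ^ k * (f ^ (k + 1)) w :=
    mul_nonneg (mul_nonneg hc0 (pow_nonneg hc1 k)) ((hf.pow _).1 w)
  have hk (k : ℕ) : HasSum (fun w => c * (1 - c) ^ k * (f ^ (k + 1)) w) (c * (1 - c) ^ k) := by
    simpa using (hf.pow (k + 1)).2.mul_left (c * (1 - c) ^ k)
  have hg : HasSum (fun k : ℕ => c * (1 - c) ^ k) 1 := by
    have := (hasSum_geometric_of_lt_one hc1 (by linarith [hc.1])).mul_left c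
    rwa [sub_sub_cancel, mul_inv_cancel₀ hc.1.ne'] at this
  have hs : Summable fun p : ℕ × List A => c * (1 - c) ^ p.1 * (f ^ (p.1 + 1)) p.2 := by
    rw [summable_prod_of_nonneg (fun p => hn p.1 p.2)]
    exact ⟨fun k => (hk k).summable, by simpa only [(hk _).tsum_eq] using hg.summable⟩
  refine ⟨fun w => by rw [star_apply h0]; exact tsum_nonneg fun k => hn k w, ?_⟩
  have ht := hs.hasSum
  rw [(ht.prod_fiberwise hk).unique hg, ← (Equiv.prodComm _ _).hasSum_iff] at ht
  refine ht.prod_fiberwise fun w => ?_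
  rw [star_apply h0]
  exact (summable_star h0 c w).hasSum

/-- The discounted Kleene star as an operation on series. -/
noncomputable def starSer {A : Type u} (c : ℝ) (f : Ser A) : Ser A := star c f

/-- The term `k = 0` is `c • f`; in all others the first factor splits off. -/
theorem starSer_eq {A : Type u} {f : Ser A} (hf : f [] = 0) (c : ℝ) :
    starSer c f = c • f + (1 - c) • (f * starSer c f) := by
  refine Ser.ext_apply fun w => ?_
  have h : HasSum (fun k : ℕ => c * (1 - c) ^ (k + 1) * (f ^ (k + 1 + 1)) w)
      ((1 - c) * (f * starSer c f) w) := by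
    have h' := (hasSum_sum fun i (_ : i ∈ Finset.range (w.length + 1)) =>
      (summable_star hf c (w.drop i)).hasSum.mul_left (f (w.take i))).mul_left (1 - c)
    simp only [← star_apply hf] at h'
    refine h'.congr_fun fun k => ?_
    rw [pow_succ' f (k + 1), Ser.mul_apply, Finset.mul_sum, Finset.mul_sum]
    exact Finset.sum_congr rfl fun i _ => by ring
  change star c f w = _
  rw [star_apply hf, (summable_star hf c w).tsum_eq_zero_add, h.tsum_eq]
  simp

/-! ### Rationality through derivative-stable cones -/

variable {A : Type u}

/-- A series is rational if it lies in a finitely generated semimodule of non-negative series that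
is stable under derivatives. -/
def IsRational (f : Ser A) : Prop :=
  ∃ N : Submodule ℝ≥0 (Ser A), N.FG ∧ f ∈ N ∧ (∀ g ∈ N, ∀ a, g.deriv a ∈ N) ∧
    ∀ g ∈ N, ∀ w, 0 ≤ g w

/-- The series of weights accepted by an automaton from a given state. -/
noncomputable def WFA.weightFrom {Q : Type} [Fintype Q] [DecidableEq Q] (W : WFA ℝ≥0 A Q) (q : Q) :
    Ser A := fun w => ((((w.map W.trans).prod *ᵥ W.final) q : ℝ≥0) : ℝ)

section WFA

variable {Q : Type} [Fintype Q] [DecidableEq Q] (W : WFA ℝ≥0 A Q)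

theorem WFA.weightFrom_nil (q : Q) : W.weightFrom q [] = W.final q := by
  simp [WFA.weightFrom]

theorem WFA.deriv_weightFrom (a : A) (q : Q) :
    (W.weightFrom q).deriv a = ∑ p, W.trans a q p • W.weightFrom p := by
  refine Ser.ext_apply fun w => ?_
  simp only [Ser.deriv_apply, Ser.sum_apply, Ser.nnreal_smul_apply, WFA.weightFrom, List.map_cons,
    List.prod_cons, ← Matrix.mulVec_mulVec]
  rw [Matrix.mulVec, dotProduct]
  push_cast
  rfl

theorem WFA.weightFrom_nonneg (q : Q) (w : List A) : 0 ≤ W.weightFrom q w := NNReal.coe_nonneg _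

theorem WFA.coe_weight (w : List A) :
    (W.weight w : ℝ) = (∑ q, W.init q • W.weightFrom q : Ser A) w := by
  simp only [WFA.weight, dotProduct, Ser.sum_apply, Ser.nnreal_smul_apply, WFA.weightFrom]
  push_cast
  rfl

end WFA

/-- States correspond to generators of the cone: transition weights are the coefficients of their
derivatives, final weights their values at the empty word. -/
theorem mem_SRat_iff {f : Ser A} : f ∈ SRat A ↔ IsStochastic f ∧ IsRational f := by
  refine and_congr_right fun _ => ⟨?_, ?_⟩
  · rintro ⟨Q, _, _, W, hW⟩
    have hf : f = ∑ q, W.init q • W.weightFrom q :=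
      Ser.ext_apply fun w => (hW w).trans (W.coe_weight w)
    have hmem (q : Q) : W.weightFrom q ∈ Submodule.span ℝ≥0 (Set.range W.weightFrom) :=
      Submodule.subset_span ⟨q, rfl⟩
    refine ⟨Submodule.span ℝ≥0 (Set.range W.weightFrom),
      Submodule.fg_span (Set.finite_range _), ?_, fun g hg a => ?_, fun g hg w => ?_⟩
    · rw [hf]
      exact Submodule.sum_mem _ fun q _ => Submodule.smul_mem _ _ (hmem q)
    · induction hg using Submodule.span_induction with
      | mem x hx =>
        obtain ⟨q, rfl⟩ := hx
        rw [W.deriv_weightFrom]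
        exact Submodule.sum_mem _ fun p _ => Submodule.smul_mem _ _ (hmem p)
      | zero => exact Submodule.zero_mem _
      | add x y _ _ hx hy => exact Submodule.add_mem _ hx hy
      | smul c x _ hx => exact Submodule.smul_mem _ c hx
    · induction hg using Submodule.span_induction with
      | mem x hx =>
        obtain ⟨q, rfl⟩ := hx
        exact W.weightFrom_nonneg q w
      | zero => exact le_rfl
      | add x y _ _ hx hy => exact add_nonneg hx hy
      | smul c x _ hx => exact mul_nonneg c.2 hx
  · rintro ⟨N, hN, hf, hd, hn⟩
    obtain ⟨n, x, rfl⟩ := Submodule.fg_iff_exists_fin_generating_family.1 hN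
    have hx (i : Fin n) : x i ∈ Submodule.span ℝ≥0 (Set.range x) := Submodule.subset_span ⟨i, rfl⟩
    obtain ⟨l, hl⟩ := (Submodule.mem_span_range_iff_exists_fun ℝ≥0).1 hf
    choose m hm using fun a i => (Submodule.mem_span_range_iff_exists_fun ℝ≥0).1 (hd _ (hx i) a)
    let W : WFA ℝ≥0 A (Fin n) := ⟨l, fun a => Matrix.of (m a), fun i => ⟨x i [], hn _ (hx i) []⟩⟩
    refine ⟨Fin n, inferInstance, inferInstance, W, fun w => ?_⟩
    have key (i : Fin n) : W.weightFrom i = x i := by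
      refine Ser.ext_apply fun w => ?_
      induction w generalizing i with
      | nil => exact W.weightFrom_nil i
      | cons a w ih =>
        have h1 := congrFun (W.deriv_weightFrom a i) w
        have h2 := congrFun (hm a i) w
        rw [Ser.deriv_apply] at h1 h2
        rw [h1, ← h2, Ser.sum_apply, Ser.sum_apply]
        exact Finset.sum_congr rfl fun j _ => by
          rw [Ser.nnreal_smul_apply, Ser.nnreal_smul_apply, ih]; rfl
    rw [W.coe_weight]
    simp only [key]
    exact (congrFun hl w).symm

theorem IsRational.convexComb {f g : Ser A} (hf : IsRational f) (hg : IsRational g) {c : ℝ}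
    (hc : c ∈ Set.Ioo (0 : ℝ) 1) : IsRational (convexComb c f g) := by
  obtain ⟨N, hN, hf, hd, hn⟩ := hf
  obtain ⟨N', hN', hg, hd', hn'⟩ := hg
  refine ⟨N ⊔ N', hN.sup hN', ?_, ?_, ?_⟩
  · exact Submodule.add_mem_sup (N.smul_mem ⟨c, hc.1.le⟩ hf)
      (N'.smul_mem ⟨1 - c, sub_nonneg.2 hc.2.le⟩ hg)
  · intro h hh a
    obtain ⟨y, hy, z, hz, rfl⟩ := Submodule.mem_sup.1 hh
    exact Submodule.add_mem_sup (hd y hy a) (hd' z hz a)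
  · intro h hh w
    obtain ⟨y, hy, z, hz, rfl⟩ := Submodule.mem_sup.1 hh
    exact add_nonneg (hn y hy w) (hn' z hz w)

theorem IsRational.mul {f g : Ser A} (hf : IsRational f) (hg : IsRational g) :
    IsRational (f * g) := by
  obtain ⟨N, hN, hf, hd, hn⟩ := hf
  obtain ⟨N', hN', hg, hd', hn'⟩ := hg
  -- The cone `N g + N'` is stable because the derivative of `y g` is `y [] • g.deriv a + y.deriv a
  -- * g`.
  refine ⟨N.map (LinearMap.mulRight ℝ≥0 g) ⊔ N', (hN.map _).sup hN', ?_, ?_, ?_⟩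
  · exact Submodule.mem_sup_left ⟨f, hf, rfl⟩
  · intro h hh a
    obtain ⟨_, ⟨y, hy, rfl⟩, z, hz, rfl⟩ := Submodule.mem_sup.1 hh
    rw [LinearMap.mulRight_apply, Ser.deriv_add, Ser.deriv_mul, add_comm (y [] • _),
      add_assoc]
    refine Submodule.add_mem_sup ⟨y.deriv a, hd y hy a, rfl⟩ ?_
    exact N'.add_mem (N'.smul_mem ⟨y [], hn y hy []⟩ (hd' g hg a)) (hd' z hz a)
  · intro h hh w
    obtain ⟨_, ⟨y, hy, rfl⟩, z, hz, rfl⟩ := Submodule.mem_sup.1 hh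
    exact add_nonneg (Ser.mul_nonneg' (hn y hy) (hn' g hg) w) (hn' z hz w)

theorem IsRational.star {f : Ser A} (hf : IsRational f) (hs : IsStochastic f) (h0 : f [] = 0)
    {c : ℝ} (hc : c ∈ Set.Ioo (0 : ℝ) 1) : IsRational (starSer c f) := by
  obtain ⟨N, hN, hf, hd, hn⟩ := hf
  have hc1 : 0 ≤ 1 - c := sub_nonneg.2 hc.2.le
  have hS := starSer_eq h0 c
  have hS0 := (hs.star h0 hc).1
  -- With this `t` the star is `f t`, and derivatives of `t` fall into `N t`, so the cone `N t` is
  -- stable.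
  set t : Ser A := c • 1 + (1 - c) • starSer c f with ht
  have hft : starSer c f = f * t := by
    rw [ht, mul_add, mul_smul_comm, mul_smul_comm, mul_one]
    exact hS
  have ht0 (w : List A) : 0 ≤ t w :=
    add_nonneg (mul_nonneg hc.1.le (isStochastic_one.1 w)) (mul_nonneg hc1 (hS0 w))
  have hdt (a : A) : t.deriv a = (1 - c) • (f.deriv a * t) := by
    have h1 : t.deriv a = (1 - c) • (starSer c f).deriv a := by
      rw [ht, Ser.deriv_add, Ser.deriv_smul, Ser.deriv_one, smul_zero, zero_add, Ser.deriv_smul]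
    rw [h1, hft, Ser.deriv_mul, h0, zero_smul, zero_add]
  refine ⟨N.map (LinearMap.mulRight ℝ≥0 t), hN.map _, ⟨f, hf, hft.symm⟩, ?_, ?_⟩
  · rintro _ ⟨y, hy, rfl⟩ a
    rw [LinearMap.mulRight_apply, Ser.deriv_mul, hdt, ← smul_mul_assoc, ← smul_mul_assoc, ← add_mul]
    exact ⟨_, N.add_mem (N.smul_mem ⟨y [], hn y hy []⟩ (N.smul_mem ⟨1 - c, hc1⟩ (hd f hf a)))
      (hd y hy a), rfl⟩
  · rintro _ ⟨y, hy, rfl⟩ w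
    exact Ser.mul_nonneg' (hn y hy) ht0 w

theorem isRational_one : IsRational (1 : Ser A) := by
  refine ⟨Submodule.span ℝ≥0 {1}, Submodule.fg_span_singleton _,
    Submodule.mem_span_singleton_self _, ?_, ?_⟩
  · intro g hg a
    obtain ⟨c, rfl⟩ := Submodule.mem_span_singleton.1 hg
    simp
  · intro g hg w
    obtain ⟨c, rfl⟩ := Submodule.mem_span_singleton.1 hg
    exact mul_nonneg c.2 (isStochastic_one.1 w)

theorem isRational_letter (b : A) : IsRational (Ser.letter b) := by
  refine ⟨Submodule.span ℝ≥0 {Ser.letter b} ⊔ Submodule.span ℝ≥0 {1},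
    (Submodule.fg_span_singleton _).sup (Submodule.fg_span_singleton _),
    Submodule.mem_sup_left (Submodule.mem_span_singleton_self _), ?_, ?_⟩
  · intro g hg a
    obtain ⟨y, hy, z, hz, rfl⟩ := Submodule.mem_sup.1 hg
    obtain ⟨c, rfl⟩ := Submodule.mem_span_singleton.1 hy
    obtain ⟨d, rfl⟩ := Submodule.mem_span_singleton.1 hz
    simp only [Ser.deriv_add, Ser.deriv_nnreal_smul, Ser.deriv_one, smul_zero, add_zero]
    refine Submodule.smul_mem _ _ (Submodule.mem_sup_right ?_)
    by_cases h : a = b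
    · subst h
      rw [Ser.deriv_letter_self]
      exact Submodule.mem_span_singleton_self _
    · rw [Ser.deriv_letter_of_ne h]
      exact Submodule.zero_mem _
  · intro g hg w
    obtain ⟨y, hy, z, hz, rfl⟩ := Submodule.mem_sup.1 hg
    obtain ⟨c, rfl⟩ := Submodule.mem_span_singleton.1 hy
    obtain ⟨d, rfl⟩ := Submodule.mem_span_singleton.1 hz
    exact add_nonneg (mul_nonneg c.2 ((isStochastic_dirac [b]).1 w))
      (mul_nonneg d.2 (isStochastic_one.1 w))

/-! ### Closure of the rational stochastic languages -/

theorem dirac_nil_mem_SRat : dirac [] ∈ SRat A :=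
  mem_SRat_iff.2 ⟨isStochastic_one, isRational_one⟩

theorem dirac_singleton_mem_SRat (a : A) : dirac [a] ∈ SRat A :=
  mem_SRat_iff.2 ⟨isStochastic_dirac [a], isRational_letter a⟩

theorem convexComb_mem_SRat {c : ℝ} (hc : c ∈ Set.Ioo (0 : ℝ) 1) {f g : QLang A} (hf : f ∈ SRat A)
    (hg : g ∈ SRat A) : convexComb c f g ∈ SRat A := by
  have hf' := mem_SRat_iff.1 hf
  have hg' := mem_SRat_iff.1 hg
  exact mem_SRat_iff.2 ⟨hf'.1.convexComb hg'.1 hc, hf'.2.convexComb hg'.2 hc⟩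

theorem cauchy_mem_SRat {f g : QLang A} (hf : f ∈ SRat A) (hg : g ∈ SRat A) :
    cauchy f g ∈ SRat A := by
  have hf' := mem_SRat_iff.1 hf
  have hg' := mem_SRat_iff.1 hg
  exact mem_SRat_iff.2 ⟨hf'.1.mul hg'.1, hf'.2.mul hg'.2⟩

theorem star_mem_SRat {c : ℝ} (hc : c ∈ Set.Ioo (0 : ℝ) 1) {f : QLang A} (hf : f ∈ SRat A)
    (h0 : f [] = 0) : star c f ∈ SRat A := by
  have hf' := mem_SRat_iff.1 hf
  exact mem_SRat_iff.2 ⟨hf'.1.star h0 hc, hf'.2.star hf'.1 h0 hc⟩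

theorem convexComb_nil {c : ℝ} {f g : QLang A} (hf : f [] = 0) (hg : g [] = 0) :
    convexComb c f g [] = 0 := by
  simp [convexComb, hf, hg]

theorem cauchy_nil {f g : QLang A} (hf : f [] = 0) : cauchy f g [] = 0 := by
  simp [cauchy, hf]

theorem star_nil {c : ℝ} {f : Ser A} (hf : f [] = 0) : star c f [] = 0 := by
  change starSer c f [] = 0
  rw [starSer_eq hf]
  simp [hf]

theorem closedUnderProperOps_SRat : ClosedUnderProperOps (SRat A) where
  convexComb_mem _ hc _ hf _ hg := convexComb_mem_SRat hc hf hg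
  cauchy_mem _ hf _ hg := cauchy_mem_SRat hf hg
  star_mem _ hc _ hf h0 := star_mem_SRat hc hf h0

theorem closedUnderOps_SRat_proper : ClosedUnderOps {f | f ∈ SRat A ∧ f [] = 0} where
  convexComb_mem _ hc _ hf _ hg :=
    ⟨convexComb_mem_SRat hc hf.1 hg.1, convexComb_nil hf.2 hg.2⟩
  cauchy_mem _ hf _ hg := ⟨cauchy_mem_SRat hf.1 hg.1, cauchy_nil hf.2⟩
  star_mem _ hc _ hf := ⟨star_mem_SRat hc hf.1 hf.2, star_nil hf.2⟩

theorem dirac_singleton_nil (a : A) : dirac [a] [] = 0 := Ser.letter_nil a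

theorem SRE.denote_mem_SRat (r : SRE A) : r.denote ∈ SRat A ∧ r.denote [] = 0 := by
  induction r with
  | sym a => exact ⟨dirac_singleton_mem_SRat a, dirac_singleton_nil a⟩
  | conv c hc r s hr hs => exact closedUnderOps_SRat_proper.convexComb_mem c hc _ hr _ hs
  | cat r s hr hs => exact closedUnderOps_SRat_proper.cauchy_mem _ hr _ hs
  | star c hc r hr => exact closedUnderOps_SRat_proper.star_mem c hc _ hr

/-! ### Cones of expressions -/

theorem IsStochastic.hasSum_smul {f : Ser A} (hf : IsStochastic f) (c : ℝ) :
    HasSum (c • f : Ser A) c := by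
  have h := hf.2.mul_left c
  rwa [mul_one] at h

/-- The series denoted by a stochastic regular expression. -/
noncomputable def SRE.ser (r : SRE A) : Ser A := r.denote

theorem SRE.ser_nil (r : SRE A) : r.ser [] = 0 := r.denote_mem_SRat.2

theorem SRE.isStochastic (r : SRE A) : IsStochastic r.ser := r.denote_mem_SRat.1.1

/-- The cone spanned by the series denoted by stochastic regular expressions. -/
def sreCone (A : Type u) : AddSubmonoid (Ser A) where
  carrier := {f | f = 0 ∨ ∃ c : ℝ, 0 < c ∧ ∃ r : SRE A, f = c • r.ser}
  zero_mem' := Or.inl rfl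
  add_mem' := by
    rintro f g (rfl | ⟨c, hc, r, rfl⟩) (rfl | ⟨d, hd, s, rfl⟩)
    · exact Or.inl (add_zero _)
    · exact Or.inr ⟨d, hd, s, zero_add _⟩
    · exact Or.inr ⟨c, hc, r, add_zero _⟩
    · have hcd : 0 < c + d := add_pos hc hd
      -- Normalising by the total mass `c + d` turns the sum into a convex combination.
      refine Or.inr ⟨c + d, hcd,
        .conv (c / (c + d)) ⟨by positivity, (div_lt_one hcd).2 (by linarith)⟩ r s, ?_⟩
      have h : (SRE.conv (c / (c + d)) ⟨by positivity, (div_lt_one hcd).2 (by linarith)⟩ r s).ser =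
        (c / (c + d)) • r.ser + (1 - c / (c + d)) • s.ser := rfl
      rw [h, smul_add, smul_smul, smul_smul]
      congr 2 <;> field_simp
      ring

theorem nil_of_mem_sreCone {f : Ser A} (hf : f ∈ sreCone A) : f [] = 0 := by
  rcases hf with rfl | ⟨c, hc, r, rfl⟩
  · rfl
  · rw [Ser.smul_apply, r.ser_nil, mul_zero]

theorem letter_mem_sreCone (a : A) : Ser.letter a ∈ sreCone A :=
  Or.inr ⟨1, one_pos, .sym a, (one_smul _ _).symm⟩

theorem smul_mem_sreCone {c : ℝ} (hc : 0 ≤ c) {f : Ser A} (hf : f ∈ sreCone A) :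
    c • f ∈ sreCone A := by
  rcases hc.eq_or_lt with rfl | hc
  · exact Or.inl (zero_smul _ _)
  · rcases hf with rfl | ⟨d, hd, r, rfl⟩
    · exact Or.inl (smul_zero _)
    · exact Or.inr ⟨c * d, mul_pos hc hd, r, smul_smul _ _ _⟩

theorem mul_mem_sreCone {f g : Ser A} (hf : f ∈ sreCone A) (hg : g ∈ sreCone A) :
    f * g ∈ sreCone A := by
  rcases hf with rfl | ⟨c, hc, r, rfl⟩
  · exact Or.inl (zero_mul _)
  · rcases hg with rfl | ⟨d, hd, s, rfl⟩
    · exact Or.inl (mul_zero _)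
    · refine Or.inr ⟨c * d, mul_pos hc hd, .cat r s, ?_⟩
      rw [smul_mul_smul_comm]
      rfl

/-- The series `c δ_ε + f` with `c ≥ 0` and `f` in the cone of stochastic regular expressions. -/
def unitalCone (A : Type u) : AddSubmonoid (Ser A) where
  carrier := {f | ∃ c : ℝ, 0 ≤ c ∧ ∃ g ∈ sreCone A, f = c • 1 + g}
  zero_mem' := ⟨0, le_rfl, 0, zero_mem _, by rw [zero_smul, add_zero]⟩
  add_mem' := by
    rintro _ _ ⟨c, hc, f, hf, rfl⟩ ⟨d, hd, g, hg, rfl⟩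
    exact ⟨c + d, add_nonneg hc hd, f + g, add_mem hf hg, by rw [add_smul]; abel⟩

/-- The proper left factor absorbs the constant term of `g`. -/
theorem mul_mem_unitalCone {f g : Ser A} (hf : f ∈ sreCone A) (hg : g ∈ unitalCone A) :
    f * g ∈ unitalCone A := by
  obtain ⟨c, hc, g, hg, rfl⟩ := hg
  refine ⟨0, le_rfl, c • f + f * g,
    add_mem (smul_mem_sreCone hc hf) (mul_mem_sreCone hf hg), ?_⟩
  rw [mul_add, mul_smul_comm, mul_one, zero_smul, zero_add]

theorem smul_mem_unitalCone {c : ℝ} (hc : 0 ≤ c) {f : Ser A} (hf : f ∈ unitalCone A) :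
    c • f ∈ unitalCone A := by
  obtain ⟨d, hd, g, hg, rfl⟩ := hf
  exact ⟨c * d, mul_nonneg hc hd, c • g, smul_mem_sreCone hc hg, by rw [smul_add, smul_smul]⟩

/-- Non-negative summable series. -/
def IsFiniteMass (f : Ser A) : Prop := (∀ w, 0 ≤ f w) ∧ Summable f

theorem eq_zero_of_hasSum_zero {f : Ser A} (hf : ∀ w, 0 ≤ f w) (h : HasSum f 0) : f = 0 :=
  (hasSum_zero_iff_of_nonneg hf).1 h

/-- If a non-zero series of finite mass satisfies `x = e x + r`, then the mass of `e` is less than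
one, so that `e` has a quasi-inverse in the cone of stochastic regular expressions. -/
theorem exists_quasi_inverse {e x r : Ser A} (he : e ∈ sreCone A) (hx : IsFiniteMass x)
    (hx0 : x ≠ 0) (hr : ∀ w, 0 ≤ r w) (h : x = r + e * x) :
    ∃ p ∈ sreCone A, p = e + e * p := by
  rcases he with rfl | ⟨c, hc, s, rfl⟩
  · exact ⟨0, zero_mem _, by rw [zero_mul, add_zero]⟩
  obtain ⟨m, hm⟩ := hx.2
  have hm0 : 0 < m := (hm.nonneg hx.1).lt_of_ne fun h0 =>
    hx0 (eq_zero_of_hasSum_zero hx.1 (h0 ▸ hm))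
  have hex : HasSum ((c • s.ser) * x : Ser A) (c * m) := by
    refine Ser.hasSum_mul (fun w => mul_nonneg hc.le (s.isStochastic.1 w)) hx.1
      (s.isStochastic.hasSum_smul c) hm
  have hrsum : HasSum r (m - c * m) := by
    have h1 := hm.sub hex
    refine h1.congr_fun fun w => ?_
    have := congrFun h w
    rw [Ser.add_apply] at this
    linarith
  -- If `c ≥ 1`, then `r` has mass `m - c * m ≤ 0`, hence vanishes, and `x = e * x` with `e` proper
  -- forces `x = 0`.
  have hc1 : c < 1 := by
    by_contra! hle
    have h1 := hrsum.nonneg hr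
    have h2 : m - c * m = 0 := by nlinarith
    rw [h2] at hrsum
    rw [eq_zero_of_hasSum_zero hr hrsum, zero_add] at h
    exact hx0 (Ser.eq_zero_of_eq_mul (by rw [Ser.smul_apply, s.ser_nil, mul_zero]) h)
  have hmem : 1 - c ∈ Set.Ioo (0 : ℝ) 1 := ⟨by linarith, by linarith⟩
  -- The star with parameter `1 - c` weights `s ^ (k + 1)` by `(1 - c) * c ^ k`; the factor turns
  -- this into `c ^ (k + 1)`.
  refine ⟨(c / (1 - c)) • starSer (1 - c) s.ser,
    Or.inr ⟨c / (1 - c), div_pos hc hmem.1, .star (1 - c) hmem s, rfl⟩, ?_⟩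
  conv_lhs => rw [starSer_eq s.ser_nil]
  rw [smul_add, smul_smul, smul_smul, smul_mul_smul_comm, div_mul_cancel₀ _ hmem.1.ne']
  congr 2
  ring

theorem nonneg_of_mem_sreCone {f : Ser A} (hf : f ∈ sreCone A) (w : List A) : 0 ≤ f w := by
  rcases hf with rfl | ⟨c, hc, r, rfl⟩
  · exact le_rfl
  · exact mul_nonneg hc.le (r.isStochastic.1 w)

theorem nonneg_of_mem_unitalCone {f : Ser A} (hf : f ∈ unitalCone A) (w : List A) : 0 ≤ f w := by
  obtain ⟨c, hc, g, hg, rfl⟩ := hf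
  exact add_nonneg (mul_nonneg hc (isStochastic_one.1 w)) (nonneg_of_mem_sreCone hg w)

/-! ### State elimination -/

/-- State elimination: the finite-mass solutions of a right-linear system with coefficients in the
cone of stochastic regular expressions lie in the unital cone. -/
theorem mem_unitalCone_of_system {ι : Type*} (x : ι → Ser A) (hx : ∀ i, IsFiniteMass (x i))
    (s : Finset ι) (p : ι → Ser A) (e : ι → ι → Ser A) (hp : ∀ i ∈ s, p i ∈ unitalCone A)
    (he : ∀ i ∈ s, ∀ j ∈ s, e i j ∈ sreCone A) (h : ∀ i ∈ s, x i = p i + ∑ j ∈ s, e i j * x j) :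
    ∀ i ∈ s, x i ∈ unitalCone A := by
  classical
  induction s using Finset.induction_on generalizing p e with
  | empty => simp
  | insert k s hk ih =>
    simp only [Finset.sum_insert hk] at h
    have hks : k ∈ insert k s := Finset.mem_insert_self k s
    have hs {i : ι} (hi : i ∈ s) : i ∈ insert k s := Finset.mem_insert_of_mem hi
    -- A zero unknown gives no control over the mass of its loop, but can simply be dropped.
    by_cases hx0 : x k = 0
    · have hmem := ih p e (fun i hi => hp i (hs hi)) (fun i hi j hj => he i (hs hi) j (hs hj))
        fun i hi => by simpa [hx0] using h i (hs hi)
      intro i hi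
      rcases Finset.mem_insert.1 hi with rfl | hi
      · rw [hx0]; exact zero_mem _
      · exact hmem i hi
    set r : Ser A := p k + ∑ j ∈ s, e k j * x j with hr
    have hrk : x k = r + e k k * x k := by rw [hr, add_assoc, add_comm (∑ j ∈ s, _)]; exact h k hks
    have hr0 (w : List A) : 0 ≤ r w := by
      rw [hr, Ser.add_apply, Ser.sum_apply]
      exact add_nonneg (nonneg_of_mem_unitalCone (hp k hks) w) (Finset.sum_nonneg fun j hj =>
        Ser.mul_nonneg' (nonneg_of_mem_sreCone (he k hks j (hs hj))) (hx j).1 w)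
    obtain ⟨q, hq, hqe⟩ := exists_quasi_inverse (he k hks k hks) (hx k) hx0 hr0 hrk
    have hxk : x k = r + q * r := by
      refine Ser.eq_of_eq_mul_add (nil_of_mem_sreCone (he k hks k hks)) hrk ?_
      conv_lhs => rw [hqe]
      noncomm_ring
    have hmem : ∀ i ∈ s, x i ∈ unitalCone A := by
      -- Substitution of `x k = (1 + q) r`, with `1 + q` expanded so that all coefficients stay
      -- proper.
      refine ih (fun i => p i + e i k * (p k + q * p k))
        (fun i j => e i j + e i k * (e k j + q * e k j)) ?_ ?_ ?_
      · exact fun i hi => add_mem (hp i (hs hi)) (mul_mem_unitalCone (he i (hs hi) k hks)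
          (add_mem (hp k hks) (mul_mem_unitalCone hq (hp k hks))))
      · exact fun i hi j hj => add_mem (he i (hs hi) j (hs hj))
          (mul_mem_sreCone (he i (hs hi) k hks)
            (add_mem (he k hks j (hs hj)) (mul_mem_sreCone hq (he k hks j (hs hj)))))
      · intro i hi
        rw [h i (hs hi), hxk, hr]
        simp only [add_mul, mul_add, Finset.sum_add_distrib, Finset.mul_sum, mul_assoc]
        abel
    intro i hi
    rcases Finset.mem_insert.1 hi with rfl | hi
    · have hrmem : r ∈ unitalCone A := add_mem (hp _ hks) (sum_mem fun j hj =>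
        mul_mem_unitalCone (he _ hks j (hs hj)) (hmem j hj))
      rw [hxk]
      exact add_mem hrmem (mul_mem_unitalCone hq hrmem)
    · exact hmem i hi

/-- Expansion by the first letter; finiteness of the alphabet makes each coefficient a finite sum of
letters. -/
theorem WFA.weightFrom_eq [Fintype A] {Q : Type} [Fintype Q] [DecidableEq Q] (W : WFA ℝ≥0 A Q)
    (q : Q) : W.weightFrom q = (W.final q : ℝ) • 1 +
      ∑ p, (∑ a, (W.trans a q p : ℝ) • Ser.letter a) * W.weightFrom p := by
  classical
  refine Ser.ext_deriv ?_ fun b => ?_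
  · simp [W.weightFrom_nil]
  · rw [W.deriv_weightFrom, Ser.deriv_add, Ser.deriv_smul, Ser.deriv_one, smul_zero, zero_add,
      Ser.deriv_sum]
    refine Finset.sum_congr rfl fun p _ => ?_
    rw [Ser.deriv_mul, Ser.deriv_sum, Ser.sum_apply, Finset.sum_eq_zero (fun a _ => by simp),
      zero_smul, zero_add, Finset.sum_eq_single b]
    · rw [Ser.deriv_smul, Ser.deriv_letter_self, smul_mul_assoc, one_mul]
      rfl
    · intro a _ hab
      rw [Ser.deriv_smul, Ser.deriv_letter_of_ne hab.symm, smul_zero]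
    · simp

theorem mem_unitalCone_of_mem_SRat [Finite A] {f : Ser A} (hf : f ∈ SRat A) :
    f ∈ unitalCone A := by
  classical
  have := Fintype.ofFinite A
  obtain ⟨hst, Q, _, _, W, hW⟩ := hf
  have hsum : f = ∑ q, W.init q • W.weightFrom q :=
    Ser.ext_apply fun w => (hW w).trans (W.coe_weight w)
  -- States that no accepted mass reaches may have infinite mass. Those of finite mass include every
  -- state of non-zero initial weight, and no transition of non-zero weight leaves them, so the
  -- system restricts to them.
  let s : Finset Q := Finset.univ.filter fun q => Summable (W.weightFrom q)
  have hmem (q : Q) (hq : W.init q ≠ 0) : q ∈ s := by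
    refine Finset.mem_filter.2 ⟨Finset.mem_univ q, ?_⟩
    have hq' : 0 < (W.init q : ℝ) := NNReal.coe_pos.2 (pos_iff_ne_zero.2 hq)
    refine (hst.2.summable.mul_left (W.init q : ℝ)⁻¹).of_nonneg_of_le (W.weightFrom_nonneg q)
      fun w => ?_
    rw [← div_eq_inv_mul, le_div_iff₀' hq', hsum, Ser.sum_apply]
    exact Finset.single_le_sum (f := fun q => (W.init q • W.weightFrom q : Ser A) w)
      (fun p _ => mul_nonneg (W.init p).2 (W.weightFrom_nonneg p w)) (Finset.mem_univ q)
  have hstep (q : Q) (hq : q ∈ s) (p : Q) (hp : p ∉ s) (a : A) : W.trans a q p = 0 := by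
    by_contra h0
    refine hp (Finset.mem_filter.2 ⟨Finset.mem_univ p, ?_⟩)
    have h0' : 0 < (W.trans a q p : ℝ) := NNReal.coe_pos.2 (pos_iff_ne_zero.2 h0)
    have hqs : Summable fun w => W.weightFrom q (a :: w) :=
      (Finset.mem_filter.1 hq).2.comp_injective (List.cons_injective (a := a))
    refine (hqs.mul_left (W.trans a q p : ℝ)⁻¹).of_nonneg_of_le (W.weightFrom_nonneg p) fun w => ?_
    have hd : W.weightFrom q (a :: w) = _ := congrFun (W.deriv_weightFrom a q) w
    rw [← div_eq_inv_mul, le_div_iff₀' h0', hd, Ser.sum_apply]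
    exact Finset.single_le_sum (f := fun p => (W.trans a q p • W.weightFrom p : Ser A) w)
      (fun p _ => mul_nonneg (W.trans a q p).2 (W.weightFrom_nonneg p w)) (Finset.mem_univ p)
  have hcone : ∀ i : s, W.weightFrom i ∈ unitalCone A := by
    intro i
    refine mem_unitalCone_of_system (fun i : s => W.weightFrom i)
      (fun i => ⟨W.weightFrom_nonneg i, (Finset.mem_filter.1 i.2).2⟩) Finset.univ
      (fun i => (W.final i : ℝ) • 1) (fun i j => ∑ a, (W.trans a i j : ℝ) • Ser.letter a)
      (fun i _ => ⟨_, NNReal.coe_nonneg _, 0, zero_mem _, (add_zero _).symm⟩)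
      (fun i _ j _ => sum_mem fun a _ =>
        smul_mem_sreCone (NNReal.coe_nonneg _) (letter_mem_sreCone a)) (fun i _ => ?_) i
      (Finset.mem_univ i)
    rw [Finset.univ_eq_attach, Finset.sum_attach s
      (fun p => (∑ a, (W.trans a i p : ℝ) • Ser.letter a) * W.weightFrom p),
      Finset.sum_subset (Finset.subset_univ s), ← W.weightFrom_eq]
    intro p _ hp
    rw [Finset.sum_eq_zero, zero_mul]
    intro a _
    rw [hstep i i.2 p hp a, NNReal.coe_zero, zero_smul]
  rw [hsum]
  refine sum_mem fun q _ => ?_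
  by_cases hq : W.init q = 0
  · rw [hq, zero_smul]
    exact zero_mem _
  · exact smul_mem_unitalCone (W.init q).2 (hcone ⟨q, hmem q hq⟩)

/-- A rational stochastic language is the Dirac distribution at the empty word, the language of a
stochastic regular expression, or a convex combination of the two. -/
theorem exists_sre_of_mem_SRat [Finite A] {f : QLang A} (hf : f ∈ SRat A) :
    f = dirac [] ∨ ∃ r : SRE A, f = r.denote ∨
      ∃ c ∈ Set.Ioo (0 : ℝ) 1, f = convexComb c (dirac []) r.denote := by
  obtain ⟨c, hc, g, hg, hfg⟩ := mem_unitalCone_of_mem_SRat hf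
  have h1 : HasSum (c • 1 : Ser A) c := isStochastic_one.hasSum_smul c
  rcases hg with rfl | ⟨d, hd, r, rfl⟩
  · rw [add_zero] at hfg
    rw [← hfg] at h1
    rw [h1.unique hf.1.2, one_smul] at hfg
    exact Or.inl hfg
  · have h2 : HasSum (d • r.ser : Ser A) d := r.isStochastic.hasSum_smul d
    have h3 : HasSum f (c + d) := by rw [hfg]; exact h1.add h2
    have hcd : c + d = 1 := h3.unique hf.1.2
    -- Comparing total masses fixes the coefficients.
    obtain rfl : d = 1 - c := by linarith
    refine Or.inr ⟨r, ?_⟩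
    rcases hc.eq_or_lt with rfl | hc
    · refine Or.inl ?_
      rw [sub_zero, zero_smul, zero_add, one_smul] at hfg
      exact hfg
    · exact Or.inr ⟨c, ⟨hc, by linarith⟩, hfg⟩

/-- Expressions are proper, so the value at the empty word is the coefficient of `dirac []`. -/
theorem exists_sre_of_mem_SRat_of_nil [Finite A] {f : QLang A} (hf : f ∈ SRat A) (h0 : f [] = 0) :
    ∃ r : SRE A, r.denote = f := by
  rcases exists_sre_of_mem_SRat hf with rfl | ⟨r, rfl | ⟨c, hc, rfl⟩⟩
  · simp [dirac] at h0
  · exact ⟨r, rfl⟩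
  · simp [convexComb, dirac, r.denote_mem_SRat.2, hc.1.ne'] at h0

/-- Serves both minimality claims: every star in an expression is applied to a proper series. -/
theorem SRE.denote_mem {C : Set (QLang A)} (hd : ∀ a, dirac [a] ∈ C) (hC : ClosedUnderProperOps C)
    (r : SRE A) : r.denote ∈ C := by
  induction r with
  | sym a => exact hd a
  | conv c hc r s hr hs => exact hC.convexComb_mem c hc _ hr _ hs
  | cat r s hr hs => exact hC.cauchy_mem _ hr _ hs
  | star c hc r hr => exact hC.star_mem c hc _ hr r.denote_mem_SRat.2

theorem ClosedUnderOps.proper {C : Set (QLang A)} (hC : ClosedUnderOps C) :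
    ClosedUnderProperOps C :=
  ⟨hC.convexComb_mem, hC.cauchy_mem, fun c hc f hf _ => hC.star_mem c hc f hf⟩

end StochLang

theorem mainTheorem2 (A : Type*) [Finite A] :
    IsLeast
      {C : Set (StochLang.QLang A) |
        (∀ a : A, StochLang.dirac [a] ∈ C) ∧ StochLang.ClosedUnderOps C}
      {f | f ∈ StochLang.SRat A ∧ f [] = 0} ∧
    Set.range (StochLang.SRE.denote (A := A)) = {f | f ∈ StochLang.SRat A ∧ f [] = 0} ∧
    IsLeast
      {C : Set (StochLang.QLang A) |
        StochLang.dirac [] ∈ C ∧ (∀ a : A, StochLang.dirac [a] ∈ C) ∧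
          StochLang.ClosedUnderProperOps C}
      (StochLang.SRat A) := by
  refine ⟨⟨⟨fun a => ⟨StochLang.dirac_singleton_mem_SRat a, StochLang.dirac_singleton_nil a⟩,
    StochLang.closedUnderOps_SRat_proper⟩, ?_⟩, ?_, ⟨StochLang.dirac_nil_mem_SRat,
    StochLang.dirac_singleton_mem_SRat, StochLang.closedUnderProperOps_SRat⟩, ?_⟩
  · rintro C ⟨hd, hC⟩ f ⟨hf, h0⟩
    obtain ⟨r, rfl⟩ := StochLang.exists_sre_of_mem_SRat_of_nil hf h0
    exact r.denote_mem hd hC.proper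
  · refine Set.Subset.antisymm ?_ fun f hf => StochLang.exists_sre_of_mem_SRat_of_nil hf.1 hf.2
    rintro _ ⟨r, rfl⟩
    exact r.denote_mem_SRat
  · rintro C ⟨h1, hd, hC⟩ f hf
    rcases StochLang.exists_sre_of_mem_SRat hf with rfl | ⟨r, rfl | ⟨c, hc, rfl⟩⟩
    · exact h1
    · exact r.denote_mem hd hC
    · exact hC.convexComb_mem c hc _ h1 _ (r.denote_mem hd hC)
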